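/- Consider one macro transmission point and a finite set $B$ of pico transmission points assigned to it, together with a finite set $U$ of users, each associated with the macro and with exactly one pico; let $U^{(b)}$ be the set of users associated with pico $b$. User $u$ has a weight $w_u>0$, a peak rate $R_{u,1}>0$ from the macro, peak rates $R_{u,b}>0$ from the picos $b\in B$, and rate limits $0\le R_u^{\min}\le R_u^{\max}\le\infty$ with $R_u^{\min}<\infty$. For a macro budget $\Gamma$ and a vector of pico budgets $\boldsymbol\Gamma=(\Gamma_b)_{b\in B}$ let $\hat O(\Gamma,\boldsymbol\Gamma)$ be the optimal value of $$\max\ \sum_{b\in B}\sum_{u\in U^{(b)}}\bigl(w_uR_{u,1}\theta_u+w_uR_{u,b}\gamma_{u,b}\bigr)$$ over all $\theta_u,\gamma_{u,b}\in[0,1]$ subject to $$\sum_{u\in U}\theta_u\le\Gamma,\qquad \sum_{u\in U^{(b)}}\gamma_{u,b}\le\Gamma_b\ \ (b\in B),\qquad R_{u,1}\theta_u+R_{u,b}\gamma_{u,b}\in[R_u^{\min},R_u^{\max}]\cap\mathbb R\ \ (b\in B,\ u\in U^{(b)}).$$ Let $\bar h(g,b)$ be the minimum macro resource needed, in addition to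 the budget $g$ of pico $b$, to accommodate the minimum rates of the users of $b$, that is, the infimum of $\sum_{u\in U^{(b)}}\theta_u$ over all $\theta_u,\gamma_u\ge0$ with $\sum_{u\in U^{(b)}}\gamma_u\le g$ and $R_{u,1}\theta_u+R_{u,b}\gamma_u\ge R_u^{\min}$ for all $u\in U^{(b)}$. Let $\mathbf e_b$ denote the unit vector of $b$. Let $\Gamma\in[0,1]$ and $\Gamma_b\in[0,1]$ ($b\in B$) be budgets with $\Gamma\ge\sum_{b\in B}\bar h(\Gamma_b,b)$. Then the problem is feasible and its maximum is attained for all budgets that are componentwise at least $(\Gamma,\boldsymbol\Gamma)$, and for any $b_1,b_2\in B$ (possibly equal) and any non-negative reals $\delta,\tilde\delta,\delta_{b_1},\tilde\delta_{b_2}$, $$\hat O(\Gamma,\boldsymbol\Gamma)-\hat O(\Gamma+\delta,\boldsymbol\Gamma+\delta_{b_1}\mathbf e_{b_1})\le \hat O(\Gamma+\tilde\delta,\boldsymbol\Gamma+\tilde\delta_{b_2}\mathbf e_{b_2})-\hat O(\Gamma+\tilde\delta+\delta,\boldsymbol\Gamma+\delta_{b_1}\mathbf e_{b_1}+\tilde\delta_{b_2}\mathbf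 e_{b_2}).$$ -/

import Mathlib

/-- The data of the sub-problem of one macro transmission point (TP): `U` is the set of users
associated with the macro, `B` the set of its pico TPs. `assoc u` is the one pico TP that user `u`
is associated with, `weight u` its weight, `macroRate u` and `picoRate u b` its peak rates from the
macro and from pico `b`, and `rateMin u`, `rateMax u` its rate limits; `rateMax u = ⊤` means that
there is no upper limit. -/
structure MacroCell (U B : Type*) where
  assoc : U → B
  weight : U → ℝ
  macroRate : U → ℝ
  picoRate : U → B → ℝ
  rateMin : U → ℝ
  rateMax : U → EReal
  weight_pos : ∀ u, 0 < weight u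
  macroRate_pos : ∀ u, 0 < macroRate u
  picoRate_pos : ∀ u b, 0 < picoRate u b
  rateMin_nonneg : ∀ u, 0 ≤ rateMin u
  rateMin_le_rateMax : ∀ u, (rateMin u : EReal) ≤ rateMax u

namespace MacroCell

variable {U B : Type*} [Fintype U] [Fintype B] [DecidableEq B]

/-- The set of the users associated with pico `b`. -/
def users (P : MacroCell U B) (b : B) : Finset U :=
  Finset.univ.filter fun u => P.assoc u = b

/-- The rate of a user `u` that gets the fraction `t` of the macro resource and the fraction `g` of
the resource of pico `b`. -/
def rate (P : MacroCell U B) (u : U) (b : B) (t g : ℝ) : ℝ :=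
  P.macroRate u * t + P.picoRate u b * g

/-- Feasibility of the allocation fractions `θ u` (macro) and `γ u b` (picos) for the macro budget
`Γ` and the pico budgets `Γv`. Values `γ u b` with `u` not associated with `b` are irrelevant. -/
structure Feasible (P : MacroCell U B) (Γ : ℝ) (Γv : B → ℝ) (θ : U → ℝ) (γ : U → B → ℝ) :
    Prop where
  theta_mem : ∀ u, θ u ∈ Set.Icc (0 : ℝ) 1
  gamma_mem : ∀ u b, γ u b ∈ Set.Icc (0 : ℝ) 1
  macro_budget : ∑ u, θ u ≤ Γ
  pico_budget : ∀ b, ∑ u ∈ P.users b, γ u b ≤ Γv b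
  rate_ge : ∀ b, ∀ u ∈ P.users b, P.rateMin u ≤ P.rate u b (θ u) (γ u b)
  rate_le : ∀ b, ∀ u ∈ P.users b, (P.rate u b (θ u) (γ u b) : EReal) ≤ P.rateMax u

/-- The weighted sum rate of an allocation. -/
def weightedSumRate (P : MacroCell U B) (θ : U → ℝ) (γ : U → B → ℝ) : ℝ :=
  ∑ b, ∑ u ∈ P.users b,
    (P.weight u * P.macroRate u * θ u + P.weight u * P.picoRate u b * γ u b)

/-- All weighted sum rates that feasible allocations achieve. -/
def attainable (P : MacroCell U B) (Γ : ℝ) (Γv : B → ℝ) : Set ℝ :=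
  {s | ∃ θ γ, P.Feasible Γ Γv θ γ ∧ s = P.weightedSumRate θ γ}

/-- The optimal value of the weighted sum rate problem with macro budget `Γ`, pico budgets `Γv`. -/
noncomputable def optValue (P : MacroCell U B) (Γ : ℝ) (Γv : B → ℝ) : ℝ :=
  sSup (P.attainable Γ Γv)

/-- The minimum macro resource that is needed, in addition to the budget `g` of pico `b`, to
accommodate the minimum rates of all users associated with `b`. -/
noncomputable def minMacro (P : MacroCell U B) (g : ℝ) (b : B) : ℝ :=
  sInf {Z : ℝ | ∃ θ γ : U → ℝ, (∀ u ∈ P.users b, 0 ≤ θ u ∧ 0 ≤ γ u) ∧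
    ∑ u ∈ P.users b, θ u ≤ Z ∧ ∑ u ∈ P.users b, γ u ≤ g ∧
    ∀ u ∈ P.users b, P.rateMin u ≤ P.rate u b (θ u) (γ u)}

end MacroCell

/-! The claim is the case of single-pico increments of `O(s) + O(s+a+c) ≤ O(s+a) + O(s+c)` for
arbitrary nonnegative resource vectors `a`, `c` (`optValue_add_optValue_le`). Let `y` be optimal at
`s` and `x` at `s+a+c`, and let `p`, `q` be Lagrange prices at `s+a` and `s+c`, optimal up to `ε`
(`exists_prices`). Weak duality bounds `O(s+a)` and `O(s+c)` below using any allocations `x'`, `y'`,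
whether or not they respect the budgets. Each user draws on only two resources, which are
substitutes for its rate. Hence `x + y` can be re-split, user by user, as `x' + y'` whose cost at
`p`, `q` is at most that of `x` at `p ⊓ q` plus that of `y` at `p ⊔ q` (`exists_exchange`). The
value is linear, so its total is unchanged. Inserting the budgets and `p ⊓ q + p ⊔ q = p + q` leaves
the slack `(p - p ⊓ q)·a + (q - p ⊓ q)·c ≥ 0`. -/

namespace MacroCell

/-! ### Single users: admissible pairs and exchange -/

section Allocation

variable {U B : Type*}

/-- The pairs of macro and pico fractions that satisfy the constraints of a single user. -/
def userRegion (P : MacroCell U B) (u : U) : Set (ℝ × ℝ) :=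
  Set.Icc 0 1 ∩ (fun x : ℝ × ℝ => P.rate u (P.assoc u) x.1 x.2) ⁻¹'
    {r : ℝ | P.rateMin u ≤ r ∧ (r : EReal) ≤ P.rateMax u}

/-- The allocations that satisfy the constraints of all users, without budgets. -/
def allocations (P : MacroCell U B) : Set (U → ℝ × ℝ) :=
  Set.univ.pi P.userRegion

lemma ordConnected_rates (P : MacroCell U B) (u : U) :
    {r : ℝ | P.rateMin u ≤ r ∧ (r : EReal) ≤ P.rateMax u}.OrdConnected :=
  ⟨fun _ hx _ hy _ hz => ⟨hx.1.trans hz.1, (EReal.coe_le_coe_iff.2 hz.2).trans hy.2⟩⟩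

lemma isClosed_rates (P : MacroCell U B) (u : U) :
    IsClosed {r : ℝ | P.rateMin u ≤ r ∧ (r : EReal) ≤ P.rateMax u} :=
  (isClosed_le continuous_const continuous_id).inter
    (isClosed_le continuous_coe_real_ereal continuous_const)

lemma isCompact_userRegion (P : MacroCell U B) (u : U) : IsCompact (P.userRegion u) := by
  refine isCompact_Icc.inter_right ((P.isClosed_rates u).preimage ?_)
  unfold rate
  fun_prop

lemma convex_userRegion (P : MacroCell U B) (u : U) : Convex ℝ (P.userRegion u) := by
  refine (convex_Icc _ _).inter ((P.ordConnected_rates u).convex.is_linear_preimage ?_)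
  constructor
  · intro x y; simp only [rate, Prod.fst_add, Prod.snd_add]; ring
  · intro c x; simp only [rate, Prod.smul_fst, Prod.smul_snd, smul_eq_mul]; ring

lemma isCompact_allocations (P : MacroCell U B) : IsCompact P.allocations :=
  isCompact_univ_pi P.isCompact_userRegion

lemma convex_allocations (P : MacroCell U B) : Convex ℝ P.allocations :=
  convex_pi fun u _ => P.convex_userRegion u

/-- Swapping the pico fractions of two comparable allocations of a user keeps them admissible. -/
lemma swap_mem_userRegion (P : MacroCell U B) (u : U) {x y : ℝ × ℝ}
    (hx : x ∈ P.userRegion u) (hy : y ∈ P.userRegion u) (hxy : x ≤ y) :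
    (x.1, y.2) ∈ P.userRegion u ∧ (y.1, x.2) ∈ P.userRegion u := by
  have hR := (P.macroRate_pos u).le
  have hS := (P.picoRate_pos u (P.assoc u)).le
  have h1 := mul_le_mul_of_nonneg_left hxy.1 hR
  have h2 := mul_le_mul_of_nonneg_left hxy.2 hS
  refine ⟨⟨⟨⟨hx.1.1.1, hy.1.1.2⟩, ⟨hx.1.2.1, hy.1.2.2⟩⟩, ?_⟩,
    ⟨⟨⟨hy.1.1.1, hx.1.1.2⟩, ⟨hy.1.2.1, hx.1.2.2⟩⟩, ?_⟩⟩
  -- The rate is increasing in both fractions, so each mixed point has a rate between those of `x`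
  -- and `y`.
  all_goals
    refine (P.ordConnected_rates u).out hx.2 hy.2 ⟨?_, ?_⟩ <;> simp only [rate] <;> linarith

/-- Exchange property of the demand of a single user for the prices `p` and `q`. -/
lemma exists_exchange (P : MacroCell U B) (u : U) {x y : ℝ × ℝ}
    (hx : x ∈ P.userRegion u) (hy : y ∈ P.userRegion u) (p q : ℝ × ℝ) :
    ∃ x' ∈ P.userRegion u, ∃ y' ∈ P.userRegion u, x' + y' = x + y ∧
      (p.1 * x'.1 + p.2 * x'.2) + (q.1 * y'.1 + q.2 * y'.2) ≤
        (min p.1 q.1 * x.1 + min p.2 q.2 * x.2) + (max p.1 q.1 * y.1 + max p.2 q.2 * y.2) := by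
  have swap : x ≤ y ∨ y ≤ x →
      (x.1, y.2) ∈ P.userRegion u ∧ (y.1, x.2) ∈ P.userRegion u := by
    rintro (h | h)
    · exact P.swap_mem_userRegion u hx hy h
    · exact (P.swap_mem_userRegion u hy hx h).symm
  have e1 : (x.1, y.2) + (y.1, x.2) = x + y := by ext <;> simp [add_comm]
  have e2 : (y.1, x.2) + (x.1, y.2) = x + y := by ext <;> simp [add_comm]
  have key : (x ≤ y ∨ y ≤ x) ∨ (y.1 ≤ x.1 ∧ x.2 ≤ y.2) ∨ (x.1 ≤ y.1 ∧ y.2 ≤ x.2) := by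
    simp only [Prod.le_def]
    rcases le_total x.1 y.1 with h | h <;> rcases le_total x.2 y.2 with h' | h' <;> simp [h, h']
  rcases le_total p.1 q.1 with h1 | h1 <;> rcases le_total p.2 q.2 with h2 | h2 <;>
    simp only [h1, h2, min_eq_left, min_eq_right, max_eq_left, max_eq_right]
  · exact ⟨x, hx, y, hy, rfl, le_rfl⟩
  -- With oppositely ordered prices the swap would give equality. For incomparable pairs it may
  -- violate the rate limits, but then keeping or exchanging the whole pairs is already cheap
  -- enough.
  · rcases key with h | h | h
    · exact ⟨_, (swap h).1, _, (swap h).2, e1, by simp only; linarith⟩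
    · exact ⟨x, hx, y, hy, rfl, by nlinarith⟩
    · exact ⟨y, hy, x, hx, add_comm _ _, by nlinarith⟩
  · rcases key with h | h | h
    · exact ⟨_, (swap h).2, _, (swap h).1, e2, by simp only; linarith⟩
    · exact ⟨y, hy, x, hx, add_comm _ _, by nlinarith⟩
    · exact ⟨x, hx, y, hy, rfl, by nlinarith⟩
  · exact ⟨y, hy, x, hx, add_comm _ _, by linarith⟩

end Allocation

/-! ### Reformulation as a linear program over a compact convex set -/

variable {U B : Type*} [Fintype U] [Fintype B] [DecidableEq B]

/-- The weighted sum rate of an allocation, as a linear map. -/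
def value (P : MacroCell U B) : (U → ℝ × ℝ) →ₗ[ℝ] ℝ where
  toFun x := ∑ u, P.weight u * P.rate u (P.assoc u) (x u).1 (x u).2
  map_add' x y := by
    rw [← Finset.sum_add_distrib]
    refine Finset.sum_congr rfl fun u _ => ?_
    simp only [rate, Pi.add_apply, Prod.fst_add, Prod.snd_add]; ring
  map_smul' c x := by
    simp only [rate, Pi.smul_apply, Prod.smul_fst, Prod.smul_snd, smul_eq_mul, RingHom.id_apply,
      Finset.mul_sum]
    refine Finset.sum_congr rfl fun u _ => ?_
    ring

/-- The macro and pico resources that an allocation uses, as a linear map. -/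
def usage (P : MacroCell U B) : (U → ℝ × ℝ) →ₗ[ℝ] ℝ × (B → ℝ) where
  toFun x := (∑ u, (x u).1, fun b => ∑ u ∈ P.users b, (x u).2)
  map_add' x y := by
    ext <;> simp [Finset.sum_add_distrib]
  map_smul' c x := by
    ext <;> simp [Finset.mul_sum]

lemma sum_users (P : MacroCell U B) (f : U → B → ℝ) :
    ∑ b, ∑ u ∈ P.users b, f u b = ∑ u, f u (P.assoc u) := by
  rw [← Finset.sum_fiberwise Finset.univ P.assoc fun u => f u (P.assoc u)]
  refine Finset.sum_congr rfl fun b _ => Finset.sum_congr rfl fun u hu => ?_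
  rw [(Finset.mem_filter.1 hu).2]

omit [Fintype B] in
lemma mem_users (P : MacroCell U B) {u : U} {b : B} : u ∈ P.users b ↔ P.assoc u = b := by
  simp [users]

lemma mem_attainable_iff (P : MacroCell U B) (Γ : ℝ) (Γv : B → ℝ) (s : ℝ) :
    s ∈ P.attainable Γ Γv ↔ ∃ x ∈ P.allocations, P.usage x ≤ (Γ, Γv) ∧ s = P.value x := by
  constructor
  · rintro ⟨θ, γ, h, rfl⟩
    refine ⟨fun u => (θ u, γ u (P.assoc u)), fun u _ => ⟨⟨⟨(h.theta_mem u).1,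
      (h.gamma_mem u _).1⟩, ⟨(h.theta_mem u).2, (h.gamma_mem u _).2⟩⟩,
      h.rate_ge _ u (P.mem_users.2 rfl), h.rate_le _ u (P.mem_users.2 rfl)⟩,
      ⟨h.macro_budget, fun b => ?_⟩, ?_⟩
    · refine le_of_eq_of_le (Finset.sum_congr rfl fun u hu => ?_) (h.pico_budget b)
      simp only [P.mem_users.1 hu]
    · rw [weightedSumRate, sum_users]
      refine Finset.sum_congr rfl fun u _ => ?_
      simp only [rate]; ring
  · rintro ⟨x, hx, hb, rfl⟩
    refine ⟨fun u => (x u).1, fun u _ => (x u).2, ⟨fun u => ?_, fun u _ => ?_, hb.1, hb.2, ?_, ?_⟩,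
      ?_⟩
    · exact ⟨(hx u trivial).1.1.1, (hx u trivial).1.2.1⟩
    · exact ⟨(hx u trivial).1.1.2, (hx u trivial).1.2.2⟩
    · intro b u hu
      rw [← P.mem_users.1 hu]
      exact (hx u trivial).2.1
    · intro b u hu
      rw [← P.mem_users.1 hu]
      exact (hx u trivial).2.2
    · rw [weightedSumRate, sum_users]
      refine Finset.sum_congr rfl fun u _ => ?_
      simp only [rate]; ring

lemma isGreatest_optValue (P : MacroCell U B) {Γ : ℝ} {Γv : B → ℝ}
    (h : (P.attainable Γ Γv).Nonempty) :
    IsGreatest (P.attainable Γ Γv) (P.optValue Γ Γv) := by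
  have e : P.attainable Γ Γv = P.value '' (P.allocations ∩ P.usage ⁻¹' Set.Iic (Γ, Γv)) := by
    ext s
    rw [mem_attainable_iff]
    constructor
    · rintro ⟨x, hx, hb, rfl⟩
      exact ⟨x, ⟨hx, hb⟩, rfl⟩
    · rintro ⟨x, ⟨hx, hb⟩, rfl⟩
      exact ⟨x, hx, hb, rfl⟩
  have hc : IsCompact (P.attainable Γ Γv) := by
    rw [e]
    exact (P.isCompact_allocations.inter_right
      (isClosed_Iic.preimage P.usage.continuous_of_finiteDimensional)).image
      P.value.continuous_of_finiteDimensional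
  exact hc.isGreatest_sSup h

lemma attainable_mono (P : MacroCell U B) {Γ Γ' : ℝ} {Γv Γv' : B → ℝ} (h : Γ ≤ Γ')
    (hv : Γv ≤ Γv') : P.attainable Γ Γv ⊆ P.attainable Γ' Γv' := by
  intro s
  rw [mem_attainable_iff, mem_attainable_iff]
  rintro ⟨x, hx, hb, rfl⟩
  exact ⟨x, hx, hb.trans ⟨h, hv⟩, rfl⟩

/-! ### Prices and approximate duality -/

/-- The cost of resources at given prices. -/
def cost (p s : ℝ × (B → ℝ)) : ℝ := p.1 * s.1 + ∑ b, p.2 b * s.2 b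

omit [DecidableEq B] in
lemma cost_add (p s t : ℝ × (B → ℝ)) : cost p (s + t) = cost p s + cost p t := by
  simp only [cost, Prod.fst_add, Prod.snd_add, Pi.add_apply, mul_add, Finset.sum_add_distrib]
  ring

omit [DecidableEq B] in
lemma cost_le_cost_right {p s t : ℝ × (B → ℝ)} (hp : 0 ≤ p) (h : s ≤ t) :
    cost p s ≤ cost p t :=
  add_le_add (mul_le_mul_of_nonneg_left h.1 hp.1)
    (Finset.sum_le_sum fun b _ => mul_le_mul_of_nonneg_left (h.2 b) (hp.2 b))

omit [DecidableEq B] in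
lemma cost_le_cost_left {p q s : ℝ × (B → ℝ)} (hs : 0 ≤ s) (h : p ≤ q) :
    cost p s ≤ cost q s :=
  add_le_add (mul_le_mul_of_nonneg_right h.1 hs.1)
    (Finset.sum_le_sum fun b _ => mul_le_mul_of_nonneg_right (h.2 b) (hs.2 b))

omit [DecidableEq B] in
lemma cost_inf_add_cost_sup (p q s : ℝ × (B → ℝ)) :
    cost (p ⊓ q) s + cost (p ⊔ q) s = cost p s + cost q s := by
  have h1 : ∀ a b c : ℝ, (a ⊓ b) * c + (a ⊔ b) * c = a * c + b * c := fun a b c => by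
    rw [← add_mul, inf_add_sup, add_mul]
  have h2 := Finset.sum_congr rfl fun b (_ : b ∈ Finset.univ) => h1 (p.2 b) (q.2 b) (s.2 b)
  rw [Finset.sum_add_distrib, Finset.sum_add_distrib] at h2
  have h3 := h1 p.1 q.1 s.1
  simp only [cost, Prod.fst_inf, Prod.snd_inf, Prod.fst_sup, Prod.snd_sup, Pi.inf_apply,
    Pi.sup_apply]
  linarith

lemma cost_usage (P : MacroCell U B) (p : ℝ × (B → ℝ)) (x : U → ℝ × ℝ) :
    cost p (P.usage x) = ∑ u, (p.1 * (x u).1 + p.2 (P.assoc u) * (x u).2) := by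
  rw [Finset.sum_add_distrib, ← sum_users P fun u b => p.2 b * (x u).2]
  simp only [cost, usage, LinearMap.coe_mk, AddHom.coe_mk, Finset.mul_sum]

/-- Every linear functional on resources is a cost. -/
lemma exists_eq_cost (f : (ℝ × (B → ℝ)) →ₗ[ℝ] ℝ) : ∃ p, ∀ s, f s = cost p s := by
  refine ⟨(f (1, 0), fun b => f (0, Pi.single b 1)), fun s => ?_⟩
  have hs : s = s.1 • ((1, 0) : ℝ × (B → ℝ)) + ∑ b, s.2 b • ((0, Pi.single b 1) : ℝ × (B → ℝ)) := by
    ext b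
    · simp [Prod.fst_sum]
    · simp [Prod.snd_sum, Finset.sum_apply, Pi.single_apply]
  conv_lhs => rw [hs]
  simp only [map_add, map_sum, map_smul, smul_eq_mul, cost]
  refine congrArg₂ _ (mul_comm _ _) (Finset.sum_congr rfl fun b _ => mul_comm _ _)

/-- Nonnegative prices that certify the optimal value up to `ε`. -/
lemma exists_prices (P : MacroCell U B) {s : ℝ × (B → ℝ)}
    (h : (P.attainable s.1 s.2).Nonempty) {ε : ℝ} (hε : 0 < ε) :
    ∃ p : ℝ × (B → ℝ), 0 ≤ p ∧ ∀ x ∈ P.allocations,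
      P.value x + cost p s ≤ P.optValue s.1 s.2 + ε + cost p (P.usage x) := by
  obtain ⟨hmem, hub⟩ := P.isGreatest_optValue h
  set v := P.optValue s.1 s.2
  let A := P.usage.prod P.value
  -- The gap `ε` makes the sets disjoint, so strict separation applies.
  have hdisj : Disjoint (A '' P.allocations) (Set.Iic s ×ˢ Set.Ici (v + ε)) := by
    rw [Set.disjoint_left]
    rintro _ ⟨x, hx, rfl⟩ ⟨h1, h2⟩
    have h3 := hub ((P.mem_attainable_iff _ _ _).2 ⟨x, hx, h1, rfl⟩)
    have h4 : v + ε ≤ P.value x := h2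
    linarith
  obtain ⟨f, c, d, hc, hcd, hd⟩ := geometric_hahn_banach_compact_closed
    (P.convex_allocations.linear_image A)
    (P.isCompact_allocations.image A.continuous_of_finiteDimensional)
    ((convex_Iic s).prod (convex_Ici (v + ε))) (isClosed_Iic.prod isClosed_Ici) hdisj
  obtain ⟨p, hp⟩ := exists_eq_cost (f.toLinearMap.comp (LinearMap.inl ℝ (ℝ × (B → ℝ)) ℝ))
  let l := f (0, 1)
  have hf : ∀ t r, f (t, r) = cost p t + l * r := by
    intro t r
    have e : (t, r) = (t, (0 : ℝ)) + r • ((0 : ℝ × (B → ℝ)), (1 : ℝ)) := by ext <;> simp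
    rw [e, map_add, map_smul, ← hp t, smul_eq_mul, mul_comm]
    rfl
  have hc' : ∀ x ∈ P.allocations, cost p (P.usage x) + l * P.value x < c := fun x hx => by
    rw [← hf]; exact hc _ ⟨x, hx, rfl⟩
  have hd' : ∀ t ≤ s, ∀ r, v + ε ≤ r → d < cost p t + l * r := fun t ht r hr => by
    rw [← hf]; exact hd _ ⟨ht, hr⟩
  -- `Set.Iic s` contains the ray `s - k • a`, along which the separating functional stays above
  -- `d`.
  have hneg : ∀ a ≥ (0 : ℝ × (B → ℝ)), cost p a ≤ 0 := by
    intro a ha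
    by_contra! hlt
    have hsm : ∀ k : ℝ, cost p (s + (-k) • a) = cost p s - k * cost p a := fun k => by
      rw [← hp, ← hp, ← hp, map_add, map_smul, smul_eq_mul]; ring
    set k := max 0 ((cost p s + l * (v + ε) - d) / cost p a) with hk
    have hk0 : 0 ≤ k := le_max_left _ _
    have hk1 : cost p s + l * (v + ε) - d ≤ k * cost p a :=
      (div_le_iff₀ hlt).1 (le_max_right _ _)
    have hle : s + (-k) • a ≤ s := by
      have := smul_nonneg hk0 ha
      rw [neg_smul, ← sub_eq_add_neg]
      exact sub_le_self _ this
    have := hd' _ hle _ le_rfl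
    rw [hsm] at this
    linarith
  have hp1 : p.1 ≤ 0 := by
    have := hneg (1, 0) ⟨zero_le_one, le_rfl⟩
    simpa [cost] using this
  have hp2 : ∀ b, p.2 b ≤ 0 := fun b => by
    have := hneg (0, Pi.single b 1) ⟨le_rfl, Pi.single_nonneg.2 zero_le_one⟩
    simpa [cost, Pi.single_apply] using this
  obtain ⟨x₀, hx₀, hb₀, hv₀⟩ := (P.mem_attainable_iff _ _ _).1 hmem
  -- Evaluating both sides at the usage of an optimal `x₀` gives `0 < l * ε`, so no Slater condition
  -- is needed.
  have hl : 0 < l := by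
    have h1 := hc' x₀ hx₀
    have h2 := hd' _ hb₀ _ le_rfl
    rw [← hv₀] at h1
    by_contra! hl
    nlinarith
  have hcost : ∀ t, cost (-(l⁻¹ • p)) t = -(l⁻¹ * cost p t) := fun t => by
    simp only [cost, Prod.fst_neg, Prod.snd_neg, Prod.smul_fst, Prod.smul_snd, Pi.neg_apply,
      Pi.smul_apply, smul_eq_mul, neg_mul, Finset.sum_neg_distrib, mul_add, Finset.mul_sum, mul_assoc]
    ring
  refine ⟨-(l⁻¹ • p), ?_, fun x hx => ?_⟩
  · rw [neg_nonneg]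
    exact smul_nonpos_of_nonneg_of_nonpos (inv_nonneg.2 hl.le) ⟨hp1, hp2⟩
  · have h1 := hc' x hx
    have h2 := hd' s le_rfl _ le_rfl
    have h3 := mul_le_mul_of_nonneg_left ((h1.trans hcd).trans h2).le (inv_nonneg.2 hl.le)
    rw [mul_add, mul_add, inv_mul_cancel_left₀ hl.ne', inv_mul_cancel_left₀ hl.ne'] at h3
    rw [hcost, hcost]
    linarith

/-! ### Decreasing increments -/

/-- The optimal value has decreasing increments along nonnegative directions. -/
theorem optValue_add_optValue_le (P : MacroCell U B) {s a c : ℝ × (B → ℝ)}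
    (h : (P.attainable s.1 s.2).Nonempty) (ha : 0 ≤ a) (hc : 0 ≤ c) :
    P.optValue s.1 s.2 + P.optValue (s + a + c).1 (s + a + c).2 ≤
      P.optValue (s + a).1 (s + a).2 + P.optValue (s + c).1 (s + c).2 := by
  have mono : ∀ t ≥ s, (P.attainable t.1 t.2).Nonempty := fun t ht =>
    h.mono (P.attainable_mono ht.1 ht.2)
  have hsa : s ≤ s + a := le_add_of_nonneg_right ha
  have hsc : s ≤ s + c := le_add_of_nonneg_right hc
  have hsac : s ≤ s + a + c := hsa.trans (le_add_of_nonneg_right hc)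
  obtain ⟨y, hy, hyb, hyv⟩ := (P.mem_attainable_iff _ _ _).1 (P.isGreatest_optValue h).1
  obtain ⟨x, hx, hxb, hxv⟩ :=
    (P.mem_attainable_iff _ _ _).1 (P.isGreatest_optValue (mono _ hsac)).1
  refine le_of_forall_pos_le_add fun ε hε => ?_
  obtain ⟨p, hp, hpv⟩ := P.exists_prices (mono _ hsa) (half_pos hε)
  obtain ⟨q, hq, hqv⟩ := P.exists_prices (mono _ hsc) (half_pos hε)
  choose x' hx' y' hy' hxy hcost using fun u =>
    P.exists_exchange u (hx u trivial) (hy u trivial)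
      (p.1, p.2 (P.assoc u)) (q.1, q.2 (P.assoc u))
  have h1 := hpv x' fun u _ => hx' u
  have h2 := hqv y' fun u _ => hy' u
  have h3 : P.value x' + P.value y' = P.value x + P.value y := by
    rw [← map_add, ← map_add]
    exact congrArg _ (funext hxy)
  have h4 : cost p (P.usage x') + cost q (P.usage y') ≤
      cost (p ⊓ q) (P.usage x) + cost (p ⊔ q) (P.usage y) := by
    simp only [cost_usage, ← Finset.sum_add_distrib]
    exact Finset.sum_le_sum fun u _ => hcost u
  have h5 := cost_le_cost_right (le_inf hp hq) hxb
  have h6 := cost_le_cost_right (hp.trans le_sup_left : 0 ≤ p ⊔ q) hyb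
  have h7 := cost_le_cost_left ha (inf_le_left : p ⊓ q ≤ p)
  have h8 := cost_le_cost_left hc (inf_le_right : p ⊓ q ≤ q)
  have h9 := cost_inf_add_cost_sup p q s
  simp only [Prod.mk.eta, cost_add] at h1 h2 h5 h6
  rw [hyv, hxv]
  linarith

/-! ### Feasibility from the minimum macro resource -/

omit [Fintype B] in
/-- The minimum macro resource is attained by rates that are exactly the minimum rates. -/
lemma exists_minMacro (P : MacroCell U B) {g : ℝ} (hg : 0 ≤ g) (b : B) :
    ∃ θ γ : U → ℝ, (∀ u ∈ P.users b, 0 ≤ θ u ∧ 0 ≤ γ u ∧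
      P.rate u b (θ u) (γ u) = P.rateMin u) ∧
      ∑ u ∈ P.users b, γ u ≤ g ∧ ∑ u ∈ P.users b, θ u ≤ P.minMacro g b := by
  let K : Set (U → ℝ × ℝ) :=
    (Set.univ.pi fun u => Set.Icc (0 : ℝ × ℝ)
      (P.rateMin u / P.macroRate u, P.rateMin u / P.picoRate u b)) ∩
    ({x | ∀ u ∈ P.users b, P.rate u b (x u).1 (x u).2 = P.rateMin u} ∩
      {x | ∑ u ∈ P.users b, (x u).2 ≤ g})
  have hK : IsCompact K := by
    refine (isCompact_univ_pi fun u => isCompact_Icc).inter_right (IsClosed.inter ?_ ?_)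
    · simp only [Set.ofPred_forall, rate]
      exact isClosed_biInter fun u _ => isClosed_eq (by fun_prop) continuous_const
    · exact isClosed_le (by fun_prop) continuous_const
  have reduce : ∀ Z : ℝ, ∀ θ γ : U → ℝ, (∀ u ∈ P.users b, 0 ≤ θ u ∧ 0 ≤ γ u) →
      ∑ u ∈ P.users b, θ u ≤ Z → ∑ u ∈ P.users b, γ u ≤ g →
      (∀ u ∈ P.users b, P.rateMin u ≤ P.rate u b (θ u) (γ u)) →
      ∃ x ∈ K, ∑ u ∈ P.users b, (x u).1 ≤ Z := by
    intro Z θ γ h0 hZ hg' hr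
    have hu : ∀ u, ∃ y : ℝ × ℝ, y ∈ Set.Icc (0 : ℝ × ℝ)
        (P.rateMin u / P.macroRate u, P.rateMin u / P.picoRate u b) ∧
        (u ∈ P.users b → P.rate u b y.1 y.2 = P.rateMin u ∧ y.1 ≤ θ u ∧ y.2 ≤ γ u) := by
      intro u
      have hM := P.macroRate_pos u
      have hS := P.picoRate_pos u b
      have hm := P.rateMin_nonneg u
      by_cases hub : u ∈ P.users b
      · obtain ⟨ht, hγ⟩ := h0 u hub
        have hr' := hr u hub
        -- Shrinking the pair by `k` hits the minimum rate exactly without using more resource, and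
        -- puts it into the compact box.
        obtain ⟨k, hk0, hk1, hk⟩ : ∃ k : ℝ, 0 ≤ k ∧ k ≤ 1 ∧
            k * P.rate u b (θ u) (γ u) = P.rateMin u := by
          rcases hm.eq_or_lt with h | h
          · exact ⟨0, le_rfl, zero_le_one, by rw [zero_mul, h]⟩
          · have hpos := h.trans_le hr'
            exact ⟨P.rateMin u / P.rate u b (θ u) (γ u), by positivity,
              (div_le_one hpos).2 hr', div_mul_cancel₀ _ hpos.ne'⟩
        have e : P.macroRate u * (k * θ u) + P.picoRate u b * (k * γ u) = P.rateMin u := by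
          rw [← hk, rate]; ring
        have hkt := mul_nonneg hk0 ht
        have hkg := mul_nonneg hk0 hγ
        have hMt := mul_nonneg hM.le hkt
        have hSg := mul_nonneg hS.le hkg
        refine ⟨(k * θ u, k * γ u), ⟨⟨hkt, hkg⟩, ⟨?_, ?_⟩⟩, fun _ =>
          ⟨e, mul_le_of_le_one_left ht hk1, mul_le_of_le_one_left hγ hk1⟩⟩
        · exact (le_div_iff₀' hM).2 (by linarith)
        · exact (le_div_iff₀' hS).2 (by linarith)
      · exact ⟨0, ⟨le_rfl, ⟨by positivity, by positivity⟩⟩, fun h => absurd h hub⟩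
    choose x hx hx' using hu
    exact ⟨x, ⟨fun u _ => hx u, fun u h => (hx' u h).1,
      (Finset.sum_le_sum fun u h => (hx' u h).2.2).trans hg'⟩,
      (Finset.sum_le_sum fun u h => (hx' u h).2.1).trans hZ⟩
  have base : ∀ u ∈ P.users b, P.rateMin u ≤
      P.rate u b (P.rateMin u / P.macroRate u) 0 := fun u _ => by
    rw [rate, mul_zero, add_zero, mul_div_cancel₀ _ (P.macroRate_pos u).ne']
  have base0 : ∀ u ∈ P.users b, 0 ≤ P.rateMin u / P.macroRate u ∧ (0 : ℝ) ≤ 0 := fun u _ =>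
    ⟨div_nonneg (P.rateMin_nonneg u) (P.macroRate_pos u).le, le_rfl⟩
  obtain ⟨x₀, hx₀, -⟩ := reduce _ _ (fun _ => 0) base0 le_rfl (by simpa using hg) base
  obtain ⟨x, hx, hmin⟩ := hK.exists_isMinOn ⟨x₀, hx₀⟩
    (f := fun x => ∑ u ∈ P.users b, (x u).1) (by fun_prop)
  refine ⟨fun u => (x u).1, fun u => (x u).2, fun u hu => ⟨(hx.1 u trivial).1.1,
    (hx.1 u trivial).1.2, hx.2.1 u hu⟩, hx.2.2, ?_⟩
  refine le_csInf ⟨_, _, fun _ => 0, base0, le_rfl, by simpa using hg, base⟩ ?_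
  rintro Z ⟨θ, γ, h0, hZ, hg', hr⟩
  obtain ⟨y, hy, hyZ⟩ := reduce Z θ γ h0 hZ hg' hr
  exact (hmin hy).trans hyZ

/-- Gluing the minimizers of all picos works: rates equal to the minimum respect the upper limits,
and budgets at most `1` force every fraction to be at most `1`. -/
lemma attainable_nonempty (P : MacroCell U B) {Γ : ℝ} {Γv : B → ℝ} (hΓ : Γ ≤ 1)
    (hΓv : ∀ b, Γv b ∈ Set.Icc (0 : ℝ) 1) (hfeas : ∑ b, P.minMacro (Γv b) b ≤ Γ) :
    (P.attainable Γ Γv).Nonempty := by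
  choose θ γ h hγ hθ using fun b => P.exists_minMacro (hΓv b).1 b
  have hu : ∀ u, u ∈ P.users (P.assoc u) := fun u => P.mem_users.2 rfl
  have hsum : ∑ u, θ (P.assoc u) u ≤ Γ := by
    rw [← sum_users P fun u b => θ b u]
    exact (Finset.sum_le_sum fun b _ => hθ b).trans hfeas
  refine ⟨_, (P.mem_attainable_iff _ _ _).2
    ⟨fun u => (θ (P.assoc u) u, γ (P.assoc u) u), fun u _ => ?_, ⟨hsum, fun b => ?_⟩, rfl⟩⟩
  · obtain ⟨h1, h2, h3⟩ := h _ u (hu u)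
    have h4 : θ (P.assoc u) u ≤ 1 :=
      ((Finset.single_le_sum (f := fun v => θ (P.assoc v) v)
        (fun v _ => (h _ v (hu v)).1) (Finset.mem_univ u)).trans hsum).trans hΓ
    have h5 : γ (P.assoc u) u ≤ 1 :=
      ((Finset.single_le_sum (fun v hv => (h _ v hv).2.1) (hu u)).trans (hγ _)).trans (hΓv _).2
    refine ⟨⟨⟨h1, h2⟩, ⟨h4, h5⟩⟩, ?_, ?_⟩
    · exact h3.ge
    · change (P.rate u _ _ _ : EReal) ≤ _
      rw [h3]
      exact P.rateMin_le_rateMax u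
  · refine le_of_eq_of_le (Finset.sum_congr rfl fun u hu => ?_) (hγ b)
    simp only [P.mem_users.1 hu]

end MacroCell

theorem mainTheorem5 {U B : Type*} [Fintype U] [Fintype B] [DecidableEq B]
    (P : MacroCell U B) (Γ : ℝ) (Γv : B → ℝ)
    (hΓ : Γ ∈ Set.Icc (0 : ℝ) 1) (hΓv : ∀ b, Γv b ∈ Set.Icc (0 : ℝ) 1)
    (hfeas : ∑ b, P.minMacro (Γv b) b ≤ Γ)
    (b₁ b₂ : B) (δ δ' δ₁ δ₂ : ℝ)
    (hδ : 0 ≤ δ) (hδ' : 0 ≤ δ') (hδ₁ : 0 ≤ δ₁) (hδ₂ : 0 ≤ δ₂) :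
    (∀ (Γ' : ℝ) (Γv' : B → ℝ), Γ ≤ Γ' → Γv ≤ Γv' →
      IsGreatest (P.attainable Γ' Γv') (P.optValue Γ' Γv')) ∧
    P.optValue Γ Γv - P.optValue (Γ + δ) (Γv + δ₁ • Pi.single b₁ (1 : ℝ)) ≤
      P.optValue (Γ + δ') (Γv + δ₂ • Pi.single b₂ (1 : ℝ)) -
        P.optValue (Γ + δ' + δ)
          (Γv + δ₁ • Pi.single b₁ (1 : ℝ) + δ₂ • Pi.single b₂ (1 : ℝ)) := by
  have hne := P.attainable_nonempty hΓ.2 hΓv hfeas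
  refine ⟨fun Γ' Γv' h hv => P.isGreatest_optValue (hne.mono (P.attainable_mono h hv)), ?_⟩
  have hs : ∀ (b : B) {r : ℝ}, 0 ≤ r → (0 : B → ℝ) ≤ r • Pi.single b (1 : ℝ) := fun b r hr =>
    smul_nonneg hr (Pi.single_nonneg.2 zero_le_one)
  have key := P.optValue_add_optValue_le (s := (Γ, Γv)) (a := (δ, δ₁ • Pi.single b₁ (1 : ℝ)))
    (c := (δ', δ₂ • Pi.single b₂ (1 : ℝ))) hne ⟨hδ, hs b₁ hδ₁⟩ ⟨hδ', hs b₂ hδ₂⟩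
  simp only [Prod.mk_add_mk] at key
  rw [add_right_comm Γ δ' δ]
  linarith
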